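/- **Theorem (Tighter $(\varepsilon,\delta)$-DP of PPR).** *Differential privacy.* Let $\mathcal{N}\subseteq\mathcal{X}^2$ be a symmetric neighbor relation, and let $\varepsilon,\delta\ge 0$. A mechanism $P_{Y|X}$, i.e. a family of probability distributions $P_{Y|X}(\cdot|x)$, $x\in\mathcal{X}$, on a measurable space $\mathcal{Y}$, is $(\varepsilon,\delta)$-differentially private if $P_{Y|X}(\mathcal{S}|x)\le e^{\varepsilon}P_{Y|X}(\mathcal{S}|x')+\delta$ for all $(x,x')\in\mathcal{N}$ and all measurable $\mathcal{S}\subseteq\mathcal{Y}$. *Poisson private representation (PPR).* Let $P_{Z|X}$ be a mechanism with output space $\mathcal{Z}$ and let $Q$ be a probability distribution on $\mathcal{Z}$ such that $P_{Z|X}(\cdot|x)\ll Q$ for every $x\in\mathcal{X}$. Let $1<\alpha<\infty$. Let $Z_1,Z_2,\ldots$ be i.i.d. with distribution $Q$, and let $T_1<T_2<\cdots$ be the points of a Poisson process of rate $1$ on $[0,\infty)$ independent of $(Z_i)_i$ (i.e. $T_1,T_2-T_1,T_3-T_2,\ldots$ are i.i.d. $\mathrm{Exp}(1)$). Given the input $x$,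 write $P=P_{Z|X}(\cdot|x)$ and $$\tilde T_i:=T_i\cdot\Big(\frac{\mathrm{d}P}{\mathrm{d}Q}(Z_i)\Big)^{-1},$$ with $\tilde T_i=\infty$ if $\frac{\mathrm{d}P}{\mathrm{d}Q}(Z_i)=0$. Conditionally on $(Z_i,T_i)_i$, the index $K\in\{1,2,\ldots\}$ is drawn with $$\Pr\big(K=k\,\big|\,(Z_i,T_i)_i\big)=\frac{\tilde T_k^{-\alpha}}{\sum_{i=1}^\infty\tilde T_i^{-\alpha}}.$$ The PPR of $P_{Z|X}$ with parameter $\alpha$ and proposal distribution $Q$ is the mechanism $P_{(Z_i)_i,K|X}$ that maps $x$ to the distribution of $((Z_i)_i,K)$ on $\mathcal{Z}^{\infty}\times\{1,2,\ldots\}$. *Claim.* If $P_{Z|X}$ is $(\varepsilon,\delta)$-differentially private, then the PPR $P_{(Z_i)_i,K|X}$ with parameter $\alpha>1$ is $$\big(\alpha\varepsilon+\tilde\varepsilon,\ 2(\delta+\tilde\delta)\big)\text{-differentially private}$$ (with respect to the same relation $\mathcal{N}$) for every $\tilde\varepsilon\in(0,1]$ and $\tilde\delta\in(0,1/3]$ that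 satisfy $$\alpha\le\frac{e^{-4.2}\,\tilde\delta\,\tilde\varepsilon^{2}}{-\ln\tilde\delta}+1 .$$ -/

import Mathlib

open MeasureTheory ProbabilityTheory
open scoped ENNReal

noncomputable section

/-- `(ε, δ)`-differential privacy, for the neighbor relation `N` on the data space `X`, of a
randomized mechanism given by its conditional output distributions `M x` on `Y`. -/
def IsDifferentiallyPrivate {X Y : Type*} [MeasurableSpace Y] (N : X → X → Prop)
    (M : X → Measure Y) (ε δ : ℝ) : Prop :=
  ∀ x x' : X, N x x' → ∀ S : Set Y, MeasurableSet S →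
    M x S ≤ ENNReal.ofReal (Real.exp ε) * M x' S + ENNReal.ofReal δ

namespace PPR

instance instIsProbabilityMeasureExpOne : IsProbabilityMeasure (expMeasure 1) :=
  isProbabilityMeasure_expMeasure one_pos

/-- The points of the rate-one Poisson process with gaps `e 0, e 1, …`. Indices start at `0`, so
that `arrival e i` is the `(i + 1)`-st point `e 0 + ⋯ + e i`. -/
def arrival (e : ℕ → ℝ) (i : ℕ) : ℝ := ∑ j ∈ Finset.range (i + 1), e j

/-- The joint law of the shared samples `(Z_i)`, i.i.d. with law `Q`, and the independent
i.i.d. `Exp(1)` gaps of the Poisson process `(T_i)`. -/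
def sourceLaw {Z : Type*} [MeasurableSpace Z] (Q : Measure Z) [IsProbabilityMeasure Q] :
    Measure ((ℕ → Z) × (ℕ → ℝ)) :=
  (Measure.infinitePi fun _ : ℕ => Q).prod (Measure.infinitePi fun _ : ℕ => expMeasure 1)

/-- The rescaled points `T_i * (dP/dQ (Z_i))⁻¹`, equal to `∞` where `dP/dQ (Z_i) = 0`
(almost surely `T_i > 0`). -/
def scaledTime {Z : Type*} [MeasurableSpace Z] (Q P : Measure Z)
    (ω : (ℕ → Z) × (ℕ → ℝ)) (i : ℕ) : ℝ≥0∞ :=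
  ENNReal.ofReal (arrival ω.2 i) * (P.rnDeriv Q (ω.1 i))⁻¹

/-- The conditional probability that the encoder selects the index `k`, given the samples and
the Poisson process. -/
def selectProb {Z : Type*} [MeasurableSpace Z] (α : ℝ) (Q P : Measure Z)
    (ω : (ℕ → Z) × (ℕ → ℝ)) (k : ℕ) : ℝ≥0∞ :=
  scaledTime Q P ω k ^ (-α) / ∑' i : ℕ, scaledTime Q P ω i ^ (-α)

/-- The conditional law of `((Z_i), K)` given the samples and the Poisson process. -/
def condLaw {Z : Type*} [MeasurableSpace Z] (α : ℝ) (Q P : Measure Z)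
    (ω : (ℕ → Z) × (ℕ → ℝ)) : Measure ((ℕ → Z) × ℕ) :=
  Measure.sum fun k : ℕ => selectProb α Q P ω k • Measure.dirac (ω.1, k)

/-- The law of `((Z_i), K)` for the Poisson private representation with parameter `α`,
proposal distribution `Q` and target distribution `P`. -/
def law {Z : Type*} [MeasurableSpace Z] (α : ℝ) (Q : Measure Z) [IsProbabilityMeasure Q]
    (P : Measure Z) : Measure ((ℕ → Z) × ℕ) :=
  (sourceLaw Q).bind (condLaw α Q P)

theorem measurable_scaledTime {Z : Type*} [MeasurableSpace Z] (Q P : Measure Z) (i : ℕ) :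
    Measurable fun ω : (ℕ → Z) × (ℕ → ℝ) => scaledTime Q P ω i := by
  unfold scaledTime arrival
  have h := Measure.measurable_rnDeriv P Q
  fun_prop

theorem measurable_selectProb {Z : Type*} [MeasurableSpace Z] (α : ℝ) (Q P : Measure Z) (k : ℕ) :
    Measurable fun ω : (ℕ → Z) × (ℕ → ℝ) => selectProb α Q P ω k :=
  ((measurable_scaledTime Q P k).pow_const _).div
    (Measurable.tsum fun i => (measurable_scaledTime Q P i).pow_const _)

/-- `condLaw` is a measurable family of measures, so that `law` is a genuine mixture. -/
theorem measurable_condLaw {Z : Type*} [MeasurableSpace Z] (α : ℝ) (Q P : Measure Z) :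
    Measurable (condLaw α Q P) := by
  refine Measure.measurable_of_measurable_coe _ fun S hS => ?_
  simp only [condLaw, Measure.sum_apply _ hS, Measure.smul_apply, smul_eq_mul,
    Measure.dirac_apply' _ hS]
  refine Measurable.tsum fun k => (measurable_selectProb α Q P k).mul ?_
  exact (measurable_one.indicator hS).comp (measurable_fst.prodMk measurable_const)

end PPR

end

/-!
Write `f = dP/dQ`, `f' = dP'/dQ` for the densities at two neighboring inputs and
`S = ∑ T̃_i ^ (-α)`, `S'` for the normalising sums, so that index `k` is selected with probability
`T_k ^ (-α) f(Z_k) ^ α / S`. If `f ≤ e^ε f'` everywhere, the numerators differ by a factor of at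
most `e^(αε)`. What is left is to compare the denominators, and to bound what is lost where
`f > e^ε f'`.

*Denominators.* The rescaled points form a Poisson process of rate one whatever `P` is, so `S` and
`S'` have the same law; for `α` close to `1` they are dominated by many small terms and concentrate.
Only first and second moments are used: points with `T̃_i < τ = δ'/2` exist with probability at most
`τ` (`measure_exists_scaledTime_lt_le`), and the sum over `T̃_i ≥ τ` has mean
`m = τ^(1-α)/(α-1)` and variance at most `τ^(1-2α)/(2α-1)`, so Chebyshev's inequality
(`meas_not_mem_Icc_le`) keeps it within `(1 ± ε'/4) m` up to probability `δ'/2`, by the assumed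
bound on `α`. Applied to `P` and `P'`, this gives `S' ≤ e^ε' S` outside an event of probability `2δ'`
(`measure_badEvent_le`). The moments come from Campbell's formula and its second-order analogue
(`lintegral_tsum_sourceLaw`, `lintegral_tsum_sq_le`), which rest on the fact that the densities of
the arrival times (Erlang laws) add up to `1` on `[0, ∞)`, and on a linear change of variables
(`lintegral_mul_inv_scale`).

*Numerators.* By Bernoulli's inequality
`f^α ≤ (e^ε f')^α + ψ f^α` with `ψ = α (f - e^ε f')⁺ / f` (`rpow_le_rpow_add_sub_div_mul`). On the
good event the excess is at most `∑ ψ(Z_k) T̃_k^(-α) 1{T̃_k ≥ τ} / (3m/4)`, whose mean is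
`(4/3) ∫ ψ f dQ = (4α/3) ∫ (f - e^ε f')⁺ dQ ≤ 2δ` (`lintegral_excess_le`); the last integral is at
most `δ` by `(ε, δ)`-privacy on the set `{f > e^ε f'}`.
-/

noncomputable section

namespace PPR

/-! ### Arrival times of the rate-one Poisson process -/

/-- The density of the sum of `n + 1` independent `Exp(1)` variables, with respect to Lebesgue
measure. -/
def erlangPDF (n : ℕ) : ℝ → ℝ≥0∞ :=
  (Set.Ici 0).indicator fun x => ENNReal.ofReal (x ^ n / n.factorial * Real.exp (-x))

@[fun_prop]
theorem measurable_erlangPDF (n : ℕ) : Measurable (erlangPDF n) :=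
  Measurable.indicator (by fun_prop) measurableSet_Ici

theorem expMeasure_one_eq_withDensity : expMeasure 1 = volume.withDensity (erlangPDF 0) := by
  unfold expMeasure gammaMeasure
  congr 1
  ext x
  rw [gammaPDF_eq, erlangPDF, Set.indicator_apply]
  by_cases hx : 0 ≤ x <;> simp [hx]

/-- Convolution with the `Exp(1)` density raises the index of the Erlang density. -/
theorem lintegral_erlangPDF_zero_mul (n : ℕ) (t : ℝ) :
    ∫⁻ x, erlangPDF 0 (t - x) * erlangPDF n x = erlangPDF (n + 1) t := by
  have key : ∀ x, erlangPDF 0 (t - x) * erlangPDF n x =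
      (Set.Icc 0 t).indicator
        (fun x => ENNReal.ofReal (Real.exp (-t) / n.factorial * x ^ n)) x := by
    intro x
    simp only [erlangPDF, Set.indicator_apply, Set.mem_Ici, Set.mem_Icc, sub_nonneg]
    by_cases hx : 0 ≤ x <;> by_cases hxt : x ≤ t <;> simp only [hx, hxt, and_true, and_false,
      if_true, if_false, mul_zero, zero_mul]
    rw [← ENNReal.ofReal_mul (by positivity)]
    congr 1
    have : Real.exp (-t) = Real.exp (-(t - x)) * Real.exp (-x) := by
      rw [← Real.exp_add]; ring_nf
    rw [this]
    simp
    ring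
  simp_rw [key]
  rw [lintegral_indicator measurableSet_Icc]
  by_cases ht : 0 ≤ t
  · rw [← ofReal_integral_eq_lintegral_ofReal, integral_Icc_eq_integral_Ioc,
      ← intervalIntegral.integral_of_le ht, intervalIntegral.integral_const_mul, integral_pow]
    · simp only [erlangPDF, Set.indicator_apply, Set.mem_Ici, ht, if_true]
      congr 1
      rw [Nat.factorial_succ]
      push_cast
      field_simp
      ring
    · exact (Continuous.integrableOn_Icc (by fun_prop))
    · filter_upwards [ae_restrict_mem measurableSet_Icc] with x hx
      have := hx.1
      simp only [Pi.zero_apply]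
      positivity
  · rw [Set.Icc_eq_empty ht]
    simp [erlangPDF, ht]

theorem lintegral_lintegral_erlangPDF (n : ℕ) {h : ℝ → ℝ≥0∞} (hh : Measurable h) :
    ∫⁻ x, erlangPDF n x * ∫⁻ y, erlangPDF 0 y * h (x + y) = ∫⁻ t, erlangPDF (n + 1) t * h t := by
  have shift : ∀ x, ∫⁻ y, erlangPDF 0 y * h (x + y) = ∫⁻ t, erlangPDF 0 (t - x) * h t := by
    intro x
    rw [← lintegral_add_left_eq_self (fun t => erlangPDF 0 (t - x) * h t) x]
    simp
  simp_rw [shift, ← lintegral_erlangPDF_zero_mul]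
  have : ∀ x, erlangPDF n x * ∫⁻ t, erlangPDF 0 (t - x) * h t =
      ∫⁻ t, erlangPDF n x * (erlangPDF 0 (t - x) * h t) := fun x => by
    rw [lintegral_const_mul _ (by fun_prop)]
  simp_rw [this]
  rw [lintegral_lintegral_swap (Measurable.aemeasurable (by fun_prop))]
  refine lintegral_congr fun t => ?_
  rw [← lintegral_mul_const _ (by fun_prop)]
  exact lintegral_congr fun x => by ring

/-- The law of the gaps of a rate-one Poisson process. -/
abbrev gapLaw : Measure (ℕ → ℝ) := Measure.infinitePi fun _ : ℕ => expMeasure 1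

theorem iIndepFun_gap : iIndepFun (fun (i : ℕ) (e : ℕ → ℝ) => e i) gapLaw :=
  iIndepFun_infinitePi (X := fun _ x => x) (fun _ => measurable_id)

/-- The sum of any `n + 1` gaps has density `erlangPDF n`. -/
theorem lintegral_sum_gap (s : Finset ℕ) (n : ℕ) (hs : s.card = n + 1) {h : ℝ → ℝ≥0∞}
    (hh : Measurable h) :
    ∫⁻ e, h (∑ j ∈ s, e j) ∂gapLaw = ∫⁻ t, erlangPDF n t * h t := by
  have single : ∀ i {h : ℝ → ℝ≥0∞}, Measurable h →
      ∫⁻ e, h (e i) ∂gapLaw = ∫⁻ t, erlangPDF 0 t * h t := by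
    intro i h hh
    rw [← lintegral_map (f := h) (g := fun e : ℕ → ℝ => e i) hh (by fun_prop),
      Measure.infinitePi_map_eval, expMeasure_one_eq_withDensity,
      lintegral_withDensity_eq_lintegral_mul _ (by fun_prop) hh]
    rfl
  induction n generalizing s h with
  | zero =>
    obtain ⟨i, rfl⟩ := Finset.card_eq_one.mp hs
    simpa using single i hh
  | succ n ih =>
    obtain ⟨i, t, hit, rfl, ht⟩ := Finset.card_eq_succ.mp hs
    have hind := iIndepFun_gap.indepFun_finsetSum_of_notMem (fun i => measurable_pi_apply i) hit
    have hind' := (indepFun_iff_map_prod_eq_prod_map_map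
      (Measurable.aemeasurable (by fun_prop)) (Measurable.aemeasurable (by fun_prop))).mp hind
    calc ∫⁻ e, h (∑ j ∈ insert i t, e j) ∂gapLaw
        = ∫⁻ e, (fun p : ℝ × ℝ => h (p.1 + p.2))
            ((∑ j ∈ t, fun e : ℕ → ℝ => e j) e, e i) ∂gapLaw := by
          refine lintegral_congr fun e => ?_
          simp [Finset.sum_insert hit, add_comm]
      _ = ∫⁻ x, ∫⁻ y, h (x + y) ∂(gapLaw.map fun e => e i)
            ∂(gapLaw.map (∑ j ∈ t, fun e : ℕ → ℝ => e j)) := by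
          rw [← lintegral_map (f := fun p : ℝ × ℝ => h (p.1 + p.2)) (by fun_prop) (by fun_prop),
            hind', lintegral_prod _ (Measurable.aemeasurable (by fun_prop))]
      _ = ∫⁻ e, (fun x => ∫⁻ y, erlangPDF 0 y * h (x + y)) (∑ j ∈ t, e j) ∂gapLaw := by
          have hm : Measurable (fun x => ∫⁻ y, h (x + y) ∂(gapLaw.map fun e => e i)) :=
            Measurable.lintegral_prod_right (by fun_prop)
          rw [lintegral_map hm (by fun_prop)]
          refine lintegral_congr fun e => ?_
          rw [lintegral_map (by fun_prop) (by fun_prop)]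
          simp only [Finset.sum_apply]
          rw [single i (h := fun y => h (∑ j ∈ t, e j + y)) (by fun_prop)]
      _ = _ := by
          rw [ih t ht (h := fun x => ∫⁻ y, erlangPDF 0 y * h (x + y))
              (Measurable.lintegral_prod_right (by fun_prop)),
            lintegral_lintegral_erlangPDF n hh]

theorem tsum_erlangPDF (x : ℝ) : ∑' n, erlangPDF n x = (Set.Ici 0).indicator 1 x := by
  by_cases hx : 0 ≤ x
  · simp only [erlangPDF, Set.indicator_apply, Set.mem_Ici, hx, if_true]
    have hs : HasSum (fun n : ℕ => x ^ n / n.factorial * Real.exp (-x)) 1 := by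
      have := (NormedSpace.expSeries_div_hasSum_exp x).mul_right (Real.exp (-x))
      rwa [← Real.exp_eq_exp_ℝ, ← Real.exp_add, add_neg_cancel, Real.exp_zero] at this
    rw [← ENNReal.ofReal_tsum_of_nonneg (fun n => by positivity) hs.summable, hs.tsum_eq]
    simp
  · simp [erlangPDF, hx]

theorem tsum_lintegral_erlangPDF {h : ℝ → ℝ≥0∞} (hh : Measurable h) :
    ∑' n, ∫⁻ t, erlangPDF n t * h t = ∫⁻ t in Set.Ici 0, h t := by
  rw [← lintegral_tsum fun n => Measurable.aemeasurable (by fun_prop),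
    ← lintegral_indicator measurableSet_Ici]
  refine lintegral_congr fun t => ?_
  rw [ENNReal.tsum_mul_right, tsum_erlangPDF]
  by_cases ht : 0 ≤ t <;> simp [ht]

@[fun_prop]
theorem measurable_arrival (i : ℕ) : Measurable fun e : ℕ → ℝ => arrival e i := by
  unfold arrival; fun_prop

/-- The renewal measure of the rate-one Poisson process is Lebesgue measure. -/
theorem tsum_lintegral_arrival {h : ℝ → ℝ≥0∞} (hh : Measurable h) :
    ∑' i, ∫⁻ e, h (arrival e i) ∂gapLaw = ∫⁻ t in Set.Ici 0, h t := by
  rw [← tsum_lintegral_erlangPDF hh]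
  exact tsum_congr fun i => lintegral_sum_gap _ i (by simp) hh

/-- The increment `T_(i+d+1) - T_i` is independent of `T_i` and has density `erlangPDF d`. -/
theorem lintegral_arrival_pair (i d : ℕ) {F : ℝ → ℝ → ℝ≥0∞}
    (hF : Measurable (Function.uncurry F)) :
    ∫⁻ e, F (arrival e i) (arrival e (i + d + 1)) ∂gapLaw =
      ∫⁻ e, (fun s => ∫⁻ t, erlangPDF d t * F s (s + t)) (arrival e i) ∂gapLaw := by
  set A := Finset.range (i + 1)
  set B := Finset.Ico (i + 1) (i + d + 2)
  have hAB : Disjoint A B := by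
    rw [Finset.disjoint_left]
    intro x hx hx'
    simp only [A, B, Finset.mem_range, Finset.mem_Ico] at hx hx'
    omega
  have hind := (iIndepFun_gap.indepFun_finset A B hAB (fun i => measurable_pi_apply i)).comp
    (φ := fun v : A → ℝ => ∑ j, v j) (ψ := fun v : B → ℝ => ∑ j, v j) (by fun_prop) (by fun_prop)
  have hA : ((fun v : A → ℝ => ∑ j, v j) ∘ fun (e : ℕ → ℝ) (j : A) => e j) =
      fun e => ∑ j ∈ A, e j := by
    ext e; exact Finset.sum_coe_sort A e
  have hB : ((fun v : B → ℝ => ∑ j, v j) ∘ fun (e : ℕ → ℝ) (j : B) => e j) =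
      fun e => ∑ j ∈ B, e j := by
    ext e; exact Finset.sum_coe_sort B e
  rw [hA, hB] at hind
  have hind' := (indepFun_iff_map_prod_eq_prod_map_map
      (Measurable.aemeasurable (by fun_prop)) (Measurable.aemeasurable (by fun_prop))).mp hind
  have hG : Measurable fun p : ℝ × ℝ => F p.1 (p.1 + p.2) :=
    hF.comp (f := fun p : ℝ × ℝ => (p.1, p.1 + p.2)) (by fun_prop)
  calc ∫⁻ e, F (arrival e i) (arrival e (i + d + 1)) ∂gapLaw
      = ∫⁻ e, (fun p : ℝ × ℝ => F p.1 (p.1 + p.2)) (∑ j ∈ A, e j, ∑ j ∈ B, e j) ∂gapLaw := by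
        refine lintegral_congr fun e => ?_
        have : arrival e (i + d + 1) = ∑ j ∈ A, e j + ∑ j ∈ B, e j := by
          simp only [A, B, arrival]
          rw [Finset.sum_range_add_sum_Ico _ (by omega)]
        simp only [this]
        rfl
    _ = ∫⁻ x, ∫⁻ y, F x (x + y) ∂(gapLaw.map fun e => ∑ j ∈ B, e j)
            ∂(gapLaw.map fun e => ∑ j ∈ A, e j) := by
        rw [← lintegral_map (f := fun p : ℝ × ℝ => F p.1 (p.1 + p.2)) hG (by fun_prop),
            hind', lintegral_prod _ hG.aemeasurable]
    _ = _ := by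
        have hm : Measurable (fun x => ∫⁻ y, F x (x + y) ∂(gapLaw.map fun e => ∑ j ∈ B, e j)) :=
          Measurable.lintegral_prod_right hG
        rw [lintegral_map hm (by fun_prop)]
        refine lintegral_congr fun e => ?_
        have hFx : ∀ x, Measurable fun y => F x (x + y) := fun x => hG.comp measurable_prodMk_left
        rw [lintegral_map (hFx _) (by fun_prop),
          lintegral_sum_gap B d (by simp [B]; omega) (h := fun y => F _ (_ + y)) (hFx _)]
        rfl

/-- The second factorial moment measure of the rate-one Poisson process, on ordered pairs. -/
theorem tsum_tsum_lintegral_arrival {F : ℝ → ℝ → ℝ≥0∞} (hF : Measurable (Function.uncurry F)) :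
    ∑' i, ∑' d, ∫⁻ e, F (arrival e i) (arrival e (i + d + 1)) ∂gapLaw =
      ∫⁻ s in Set.Ici 0, ∫⁻ t in Set.Ici s, F s t := by
  have hG : Measurable fun p : ℝ × ℝ => F p.1 (p.1 + p.2) :=
    hF.comp (f := fun p : ℝ × ℝ => (p.1, p.1 + p.2)) (by fun_prop)
  have hGd : ∀ d, Measurable fun p : ℝ × ℝ => erlangPDF d p.2 * F p.1 (p.1 + p.2) :=
    fun d => (by fun_prop : Measurable fun p : ℝ × ℝ => erlangPDF d p.2).mul hG
  have hGm : ∀ d, Measurable fun s => ∫⁻ t, erlangPDF d t * F s (s + t) :=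
    fun d => Measurable.lintegral_prod_right (hGd d)
  have hin : ∀ s, ∑' d, ∫⁻ t, erlangPDF d t * F s (s + t) = ∫⁻ t in Set.Ici s, F s t := by
    intro s
    rw [tsum_lintegral_erlangPDF (h := fun t => F s (s + t)) (hG.comp measurable_prodMk_left),
      ← lintegral_indicator measurableSet_Ici, ← lintegral_indicator measurableSet_Ici,
      ← lintegral_add_left_eq_self ((Set.Ici s).indicator fun t => F s t) s]
    refine lintegral_congr fun t => ?_
    simp [Set.indicator_apply]
  simp_rw [lintegral_arrival_pair _ _ hF]
  rw [ENNReal.tsum_comm]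
  have : ∀ d, ∑' i, ∫⁻ e, (fun s => ∫⁻ t, erlangPDF d t * F s (s + t)) (arrival e i) ∂gapLaw =
      ∫⁻ s in Set.Ici 0, ∫⁻ t, erlangPDF d t * F s (s + t) :=
    fun d => tsum_lintegral_arrival (hGm d)
  simp_rw [this]
  rw [← lintegral_tsum fun d => (hGm d).aemeasurable]
  simp_rw [hin]

theorem ae_arrival_pos : ∀ᵐ e ∂gapLaw, ∀ i, 0 < arrival e i := by
  rw [ae_all_iff]
  intro i
  rw [ae_iff]
  have hs : MeasurableSet {e : ℕ → ℝ | ¬ 0 < arrival e i} :=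
    (measurableSet_lt measurable_const (measurable_arrival i)).compl
  rw [← lintegral_indicator_one hs]
  have := lintegral_sum_gap (Finset.range (i + 1)) i (by simp)
    (h := (Set.Iic 0).indicator 1) (measurable_one.indicator measurableSet_Iic)
  calc _ = ∫⁻ e, (Set.Iic (0 : ℝ)).indicator (1 : ℝ → ℝ≥0∞)
        (∑ j ∈ Finset.range (i + 1), e j) ∂gapLaw := by
        refine lintegral_congr fun e => ?_
        simp [Set.indicator_apply, arrival]
    _ = 0 := by
        rw [this, lintegral_eq_zero_iff (by
          exact (measurable_erlangPDF i).mul (measurable_one.indicator measurableSet_Iic))]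
        have h0 : ∀ᵐ t : ℝ, t ≠ 0 := by simp [ae_iff]
        filter_upwards [h0] with t ht
        rcases lt_or_gt_of_ne ht with h | h
        · simp [erlangPDF, not_le.mpr h]
        · simp [not_le.mpr h]

/-! ### First and second moments of Poisson sums -/

theorem tsum_ite_lt_eq_tsum_add (i : ℕ) (f : ℕ → ℝ≥0∞) :
    ∑' j, (if i < j then f j else 0) = ∑' d, f (i + d + 1) := by
  have hinj : Function.Injective fun d : ℕ => i + d + 1 := fun a b h => by
    simp only at h; omega
  rw [← hinj.tsum_eq (f := fun j => if i < j then f j else 0)]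
  · exact tsum_congr fun d => if_pos (by omega)
  · intro j hj
    have : i < j := by
      by_contra h
      simp [h] at hj
    exact ⟨j - i - 1, by simp only; omega⟩

/-- The square of a sum, split into the diagonal and twice the pairs of increasing indices. -/
theorem sq_tsum_le (a : ℕ → ℝ≥0∞) :
    (∑' i, a i) ^ 2 ≤ ∑' i, a i ^ 2 + 2 * ∑' i, ∑' d, a i * a (i + d + 1) := by
  have hsplit : ∀ i j, a i * a j = (if i = j then a i ^ 2 else 0) +
      ((if i < j then a i * a j else 0) + (if j < i then a j * a i else 0)) := by
    intro i j
    rcases lt_trichotomy i j with h | h | h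
    · rw [if_neg h.ne, if_pos h, if_neg h.not_gt, zero_add, add_zero]
    · simp only [h, lt_irrefl, if_true, if_false, add_zero, sq]
    · rw [if_neg h.ne', if_neg h.not_gt, if_pos h, zero_add, zero_add, mul_comm]
  have hsq : (∑' i, a i) ^ 2 = ∑' i, ∑' j, a i * a j := by
    rw [sq, ← ENNReal.tsum_mul_right]
    simp_rw [ENNReal.tsum_mul_left]
  rw [hsq]
  rw [tsum_congr fun i => tsum_congr (hsplit i)]
  simp_rw [ENNReal.tsum_add]
  refine le_of_eq ?_
  congr 1
  · exact tsum_congr fun i => by rw [tsum_eq_single i (fun j hj => if_neg hj.symm)]; simp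
  · rw [ENNReal.tsum_comm (f := fun i j => if j < i then a j * a i else 0), ← two_mul]
    simp_rw [tsum_ite_lt_eq_tsum_add]

section
variable {Z : Type*} [MeasurableSpace Z] (Q : Measure Z) [IsProbabilityMeasure Q]

theorem lintegral_sample {g : Z → ℝ≥0∞} (hg : Measurable g) (i : ℕ) :
    ∫⁻ z, g (z i) ∂(Measure.infinitePi fun _ : ℕ => Q) = ∫⁻ z, g z ∂Q := by
  rw [← lintegral_map (f := g) (g := fun z : ℕ → Z => z i) hg (by fun_prop),
    Measure.infinitePi_map_eval]

theorem lintegral_sample_mul {g k : Z → ℝ≥0∞} (hg : Measurable g) (hk : Measurable k)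
    {i j : ℕ} (hij : i ≠ j) :
    ∫⁻ z, g (z i) * k (z j) ∂(Measure.infinitePi fun _ : ℕ => Q) =
      (∫⁻ z, g z ∂Q) * ∫⁻ z, k z ∂Q := by
  have hind : iIndepFun (fun (i : ℕ) (z : ℕ → Z) => z i) (Measure.infinitePi fun _ : ℕ => Q) :=
    iIndepFun_infinitePi (X := fun _ x => x) (fun _ => measurable_id)
  have h2 := (hind.indepFun hij).comp hg hk
  have h3 := lintegral_mul_eq_lintegral_mul_lintegral_of_indepFun
    (hg.comp (measurable_pi_apply i)) (hk.comp (measurable_pi_apply j)) h2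
  rw [← lintegral_sample Q hg i, ← lintegral_sample Q hk j]
  exact h3

variable {φ : Z → ℝ → ℝ≥0∞}

theorem lintegral_sourceLaw {F : (ℕ → Z) × (ℕ → ℝ) → ℝ≥0∞} (hF : Measurable F) :
    ∫⁻ ω, F ω ∂(sourceLaw Q) =
      ∫⁻ e, ∫⁻ z, F (z, e) ∂(Measure.infinitePi fun _ : ℕ => Q) ∂gapLaw :=
  lintegral_prod_symm _ hF.aemeasurable

theorem measurable_sample_arrival (hφ : Measurable (Function.uncurry φ)) (i : ℕ) :
    Measurable fun ω : (ℕ → Z) × (ℕ → ℝ) => φ (ω.1 i) (arrival ω.2 i) :=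
  hφ.comp (f := fun ω : (ℕ → Z) × (ℕ → ℝ) => (ω.1 i, arrival ω.2 i)) (by fun_prop)

/-- Campbell's formula for the marked Poisson process of the points `(Z_i, T_i)`. -/
theorem lintegral_tsum_sourceLaw (hφ : Measurable (Function.uncurry φ)) :
    ∫⁻ ω, ∑' i, φ (ω.1 i) (arrival ω.2 i) ∂(sourceLaw Q) =
      ∫⁻ z, (∫⁻ t in Set.Ici 0, φ z t) ∂Q := by
  have hz : ∀ t, Measurable fun z => φ z t := fun t => hφ.comp measurable_prodMk_right
  rw [lintegral_tsum fun i => (measurable_sample_arrival hφ i).aemeasurable,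
    lintegral_lintegral_swap hφ.aemeasurable,
    ← tsum_lintegral_arrival (h := fun t => ∫⁻ z, φ z t ∂Q) (Measurable.lintegral_prod_left' hφ)]
  refine tsum_congr fun i => ?_
  rw [lintegral_sourceLaw Q (measurable_sample_arrival hφ i)]
  exact lintegral_congr fun e => lintegral_sample Q (hz (arrival e i)) i

theorem two_mul_lintegral_lintegral_Ici_le {h : ℝ → ℝ≥0∞} (hh : Measurable h) :
    2 * ∫⁻ s in Set.Ici 0, ∫⁻ t in Set.Ici s, h s * h t ≤ (∫⁻ t in Set.Ici 0, h t) ^ 2 := by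
  set h₀ := (Set.Ici (0 : ℝ)).indicator h with hh₀
  have hm : Measurable h₀ := hh.indicator measurableSet_Ici
  have hlt : MeasurableSet {p : ℝ × ℝ | p.1 < p.2} := measurableSet_lt measurable_fst measurable_snd
  set F : ℝ → ℝ → ℝ≥0∞ := fun s t => if s < t then h₀ s * h₀ t else 0 with hFdef
  have hF : Measurable (Function.uncurry F) :=
    Measurable.ite hlt (by fun_prop) measurable_const
  have key : ∫⁻ s in Set.Ici 0, ∫⁻ t in Set.Ici s, h s * h t = ∫⁻ s, ∫⁻ t, F s t := by
    rw [← lintegral_indicator measurableSet_Ici]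
    refine lintegral_congr fun s => ?_
    by_cases hs : 0 ≤ s
    · rw [Set.indicator_of_mem (Set.mem_Ici.mpr hs), setLIntegral_congr Ioi_ae_eq_Ici.symm,
        ← lintegral_indicator measurableSet_Ioi]
      refine lintegral_congr fun t => ?_
      by_cases hst : s < t
      · simp [hFdef, hh₀, hst, hs, hs.trans hst.le]
      · simp [hFdef, hst]
    · rw [Set.indicator_of_notMem (by simpa using hs)]
      simp [hFdef, hh₀, hs]
  rw [key, ← lintegral_indicator measurableSet_Ici, ← hh₀, two_mul]
  nth_rw 2 [lintegral_lintegral_swap hF.aemeasurable]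
  rw [← lintegral_add_left (Measurable.lintegral_prod_right hF)]
  -- The two copies now live on the disjoint half-planes `s < t` and `t < s`.
  calc ∫⁻ s, (∫⁻ t, F s t) + ∫⁻ t, F t s
      ≤ ∫⁻ s, ∫⁻ t, h₀ s * h₀ t := by
        refine lintegral_mono fun s => ?_
        have hFs : Measurable fun t => F s t := hF.comp measurable_prodMk_left
        rw [← lintegral_add_left hFs]
        refine lintegral_mono fun t => ?_
        rcases lt_or_ge s t with h | h
        · simp [hFdef, h, h.not_gt]
        · simp only [hFdef, h.not_gt, if_false, zero_add]
          split_ifs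
          · rw [mul_comm]
          · exact zero_le
    _ = (∫⁻ t, h₀ t) ^ 2 := by
        simp_rw [lintegral_const_mul _ hm]
        rw [lintegral_mul_const _ hm, sq]

/-- The variance bound of a Poisson sum: its second moment exceeds the square of its mean by at
most the intensity integral of the squared summand. -/
theorem lintegral_tsum_sq_le (hφ : Measurable (Function.uncurry φ)) :
    ∫⁻ ω, (∑' i, φ (ω.1 i) (arrival ω.2 i)) ^ 2 ∂(sourceLaw Q) ≤
      (∫⁻ z, (∫⁻ t in Set.Ici 0, φ z t) ∂Q) ^ 2 + ∫⁻ z, (∫⁻ t in Set.Ici 0, φ z t ^ 2) ∂Q := by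
  have hz : ∀ t, Measurable fun z => φ z t := fun t => hφ.comp measurable_prodMk_right
  have hm := fun i => measurable_sample_arrival hφ i
  have hm₂ : ∀ i d, Measurable fun ω : (ℕ → Z) × (ℕ → ℝ) =>
      φ (ω.1 i) (arrival ω.2 i) * φ (ω.1 (i + d + 1)) (arrival ω.2 (i + d + 1)) :=
    fun i d => (hm i).mul (hm (i + d + 1))
  set h : ℝ → ℝ≥0∞ := fun t => ∫⁻ z, φ z t ∂Q with hdef
  have hh : Measurable h := Measurable.lintegral_prod_left' hφ
  have hoff : ∫⁻ ω, ∑' i, ∑' d, φ (ω.1 i) (arrival ω.2 i) *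
      φ (ω.1 (i + d + 1)) (arrival ω.2 (i + d + 1)) ∂(sourceLaw Q) =
      ∫⁻ s in Set.Ici 0, ∫⁻ t in Set.Ici s, h s * h t := by
    rw [lintegral_tsum fun i => Measurable.aemeasurable
        (Measurable.tsum fun d => hm₂ i d),
      ← tsum_tsum_lintegral_arrival (F := fun s t => h s * h t)
        (by unfold Function.uncurry; fun_prop)]
    refine tsum_congr fun i => ?_
    rw [lintegral_tsum fun d => (hm₂ i d).aemeasurable]
    refine tsum_congr fun d => ?_
    rw [lintegral_sourceLaw Q (hm₂ i d)]
    exact lintegral_congr fun e => lintegral_sample_mul Q (hz (arrival e i))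
      (hz (arrival e (i + d + 1)))
      (show i ≠ i + d + 1 by omega)
  calc ∫⁻ ω, (∑' i, φ (ω.1 i) (arrival ω.2 i)) ^ 2 ∂(sourceLaw Q)
      ≤ ∫⁻ ω, ∑' i, φ (ω.1 i) (arrival ω.2 i) ^ 2 +
          2 * ∑' i, ∑' d, φ (ω.1 i) (arrival ω.2 i) *
            φ (ω.1 (i + d + 1)) (arrival ω.2 (i + d + 1)) ∂(sourceLaw Q) :=
        lintegral_mono fun ω => sq_tsum_le _
    _ = ∫⁻ z, (∫⁻ t in Set.Ici 0, φ z t ^ 2) ∂Q +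
          2 * ∫⁻ s in Set.Ici 0, ∫⁻ t in Set.Ici s, h s * h t := by
        rw [lintegral_add_left (Measurable.tsum fun i => (hm i).pow_const 2),
          lintegral_const_mul _ (Measurable.tsum fun i =>
            Measurable.tsum fun d => hm₂ i d), hoff,
          lintegral_tsum_sourceLaw Q (φ := fun z t => φ z t ^ 2) (hφ.pow_const 2)]
    _ ≤ _ := by
        rw [add_comm, lintegral_lintegral_swap hφ.aemeasurable]
        gcongr
        exact two_mul_lintegral_lintegral_Ici_le hh

theorem ae_sourceLaw_arrival_pos : ∀ᵐ ω ∂(sourceLaw Q), ∀ i, 0 < arrival ω.2 i :=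
  Measure.quasiMeasurePreserving_snd.ae ae_arrival_pos

instance : IsProbabilityMeasure (sourceLaw Q) := by unfold sourceLaw; infer_instance

theorem ae_sourceLaw_sample {p : Z → Prop} (hp : ∀ᵐ z ∂Q, p z) :
    ∀ᵐ ω ∂(sourceLaw Q), ∀ i, p (ω.1 i) := by
  rw [ae_all_iff]
  intro i
  have h1 : ∀ᵐ z ∂(Measure.infinitePi fun _ : ℕ => Q), p (z i) :=
    (measurePreserving_eval_infinitePi (fun _ : ℕ => Q) i).quasiMeasurePreserving.ae hp
  exact Measure.quasiMeasurePreserving_fst.ae h1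
end

/-! ### Rescaled points -/

/-- Rescaling of Lebesgue measure on `[0, ∞)` by the density value `f`. For `f = 0` every rescaled
point is `∞` except that of `t = 0`, which is negligible, so both sides vanish. -/
theorem lintegral_mul_inv_scale {w : ℝ≥0∞ → ℝ≥0∞} (hw : Measurable w) (hw_top : w ∞ = 0)
    {f : ℝ≥0∞} (hf : f ≠ ∞) :
    ∫⁻ t in Set.Ici (0 : ℝ), w (ENNReal.ofReal t * f⁻¹) =
      f * ∫⁻ s in Set.Ici (0 : ℝ), w (ENNReal.ofReal s) := by
  rcases eq_or_ne f 0 with rfl | hf0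
  · rw [zero_mul, setLIntegral_congr Ioi_ae_eq_Ici.symm]
    rw [setLIntegral_congr_fun (g := fun _ => 0) measurableSet_Ioi, lintegral_zero]
    intro t ht
    have : ENNReal.ofReal t ≠ 0 := by simpa using ht
    simp [ENNReal.mul_top this, hw_top]
  · obtain ⟨c, hc, rfl⟩ : ∃ c : ℝ, 0 < c ∧ f = ENNReal.ofReal c :=
      ⟨f.toReal, ENNReal.toReal_pos hf0 hf, (ENNReal.ofReal_toReal hf).symm⟩
    rw [← lintegral_indicator measurableSet_Ici, ← lintegral_indicator measurableSet_Ici]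
    conv_lhs => rw [← Real.smul_map_volume_mul_left hc.ne']
    have hm : Measurable ((Set.Ici (0 : ℝ)).indicator
        fun t => w (ENNReal.ofReal t * (ENNReal.ofReal c)⁻¹)) :=
      Measurable.indicator (by fun_prop) measurableSet_Ici
    rw [lintegral_smul_measure, lintegral_map hm (by fun_prop), abs_of_pos hc, smul_eq_mul]
    congr 1
    refine lintegral_congr fun s => ?_
    have h1 : (0 ≤ c * s) ↔ 0 ≤ s := mul_nonneg_iff_of_pos_left hc
    have h2 : ENNReal.ofReal (c * s) * (ENNReal.ofReal c)⁻¹ = ENNReal.ofReal s := by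
      rw [ENNReal.ofReal_mul hc.le, mul_right_comm, ENNReal.mul_inv_cancel hf0 hf, one_mul]
    simp only [Set.indicator_apply, Set.mem_Ici, h1, h2]

/-- The weight `s ^ (-α)` cut off below the level `τ`. -/
def truncPow (τ α : ℝ) (s : ℝ≥0∞) : ℝ≥0∞ :=
  if ENNReal.ofReal τ ≤ s then s ^ (-α) else 0

@[fun_prop]
theorem measurable_truncPow (τ α : ℝ) : Measurable (truncPow τ α) :=
  Measurable.ite measurableSet_Ici (by fun_prop) measurable_const

theorem truncPow_top {τ α : ℝ} (hα : 0 < α) : truncPow τ α ∞ = 0 := by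
  simp [truncPow, ENNReal.top_rpow_of_neg (neg_lt_zero.mpr hα)]

theorem truncPow_le (τ α : ℝ) (s : ℝ≥0∞) : truncPow τ α s ≤ s ^ (-α) := by
  unfold truncPow
  split_ifs
  · exact le_rfl
  · exact zero_le

theorem truncPow_of_not_lt {τ : ℝ} {s : ℝ≥0∞} (α : ℝ) (h : ¬ s < ENNReal.ofReal τ) :
    truncPow τ α s = s ^ (-α) :=
  if_pos (not_lt.mp h)

theorem truncPow_sq (τ α : ℝ) (s : ℝ≥0∞) : truncPow τ α s ^ 2 = truncPow τ (2 * α) s := by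
  unfold truncPow
  split_ifs
  · rw [← ENNReal.rpow_natCast, ← ENNReal.rpow_mul]
    congr 1
    push_cast
    ring
  · simp

theorem lintegral_truncPow {τ α : ℝ} (hτ : 0 < τ) (hα : 1 < α) :
    ∫⁻ s in Set.Ici (0 : ℝ), truncPow τ α (ENNReal.ofReal s) =
      ENNReal.ofReal (τ ^ (1 - α) / (α - 1)) := by
  have h1 : ∫⁻ s in Set.Ici (0 : ℝ), truncPow τ α (ENNReal.ofReal s) =
      ∫⁻ s in Set.Ici τ, ENNReal.ofReal (s ^ (-α)) := by
    rw [← lintegral_indicator measurableSet_Ici, ← lintegral_indicator measurableSet_Ici]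
    refine lintegral_congr fun s => ?_
    simp only [Set.indicator_apply, Set.mem_Ici, truncPow]
    by_cases hs : τ ≤ s
    · have hs0 : 0 < s := hτ.trans_le hs
      simp only [hs, hs0.le, ENNReal.ofReal_le_ofReal hs, if_true]
      rw [ENNReal.ofReal_rpow_of_pos hs0]
    · have : ¬ ENNReal.ofReal τ ≤ ENNReal.ofReal s := by
        rw [not_le] at hs ⊢
        exact (ENNReal.ofReal_lt_ofReal_iff hτ).mpr hs
      simp [hs, this]
  rw [h1, setLIntegral_congr Ioi_ae_eq_Ici.symm, ← ofReal_integral_eq_lintegral_ofReal,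
    integral_Ioi_rpow_of_lt (by linarith) hτ]
  · congr 1
    rw [show -α + 1 = -(α - 1) by ring, show 1 - α = -(α - 1) by ring, neg_div_neg_eq]
  · exact integrableOn_Ioi_rpow_of_lt (by linarith) hτ
  · filter_upwards [ae_restrict_mem measurableSet_Ioi] with s hs
    exact Real.rpow_nonneg (hτ.trans hs).le _

section
variable {Z : Type*} [MeasurableSpace Z] (Q P : Measure Z) [IsProbabilityMeasure Q]
  [IsProbabilityMeasure P]

/-- A Poisson sum of a function of the rescaled points, weighted by a function of the marks: the
rescaled points form a Poisson process of rate one, with marks of law `P`. -/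
theorem lintegral_tsum_scaledTime {ψ : Z → ℝ≥0∞} (hψ : Measurable ψ) {w : ℝ≥0∞ → ℝ≥0∞}
    (hw : Measurable w) (hw_top : w ∞ = 0) :
    ∫⁻ ω, ∑' i, ψ (ω.1 i) * w (scaledTime Q P ω i) ∂(sourceLaw Q) =
      (∫⁻ z, ψ z * P.rnDeriv Q z ∂Q) * ∫⁻ s in Set.Ici (0 : ℝ), w (ENNReal.ofReal s) := by
  have hf := Measure.measurable_rnDeriv P Q
  have h := lintegral_tsum_sourceLaw Q
    (φ := fun z t => ψ z * w (ENNReal.ofReal t * (P.rnDeriv Q z)⁻¹))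
    (by unfold Function.uncurry; fun_prop)
  refine Eq.trans h ?_
  rw [← lintegral_mul_const _ (by fun_prop)]
  refine lintegral_congr_ae ?_
  filter_upwards [Measure.rnDeriv_ne_top P Q] with z hz
  rw [lintegral_const_mul _ (by fun_prop), lintegral_mul_inv_scale hw hw_top hz, mul_assoc]

variable {Q P} in
theorem lintegral_tsum_scaledTime_one (hPQ : P.AbsolutelyContinuous Q) {w : ℝ≥0∞ → ℝ≥0∞}
    (hw : Measurable w) (hw_top : w ∞ = 0) :
    ∫⁻ ω, ∑' i, w (scaledTime Q P ω i) ∂(sourceLaw Q) =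
      ∫⁻ s in Set.Ici (0 : ℝ), w (ENNReal.ofReal s) := by
  have h := lintegral_tsum_scaledTime Q P (ψ := 1) measurable_one hw hw_top
  simpa [Measure.lintegral_rnDeriv hPQ] using h

variable {Q P} in
theorem lintegral_sq_tsum_scaledTime_le (hPQ : P.AbsolutelyContinuous Q) {w : ℝ≥0∞ → ℝ≥0∞}
    (hw : Measurable w) (hw_top : w ∞ = 0) :
    ∫⁻ ω, (∑' i, w (scaledTime Q P ω i)) ^ 2 ∂(sourceLaw Q) ≤
      (∫⁻ s in Set.Ici (0 : ℝ), w (ENNReal.ofReal s)) ^ 2 +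
        ∫⁻ s in Set.Ici (0 : ℝ), w (ENNReal.ofReal s) ^ 2 := by
  have hf := Measure.measurable_rnDeriv P Q
  have h := lintegral_tsum_sq_le Q
    (φ := fun z t => w (ENNReal.ofReal t * (P.rnDeriv Q z)⁻¹))
    (by unfold Function.uncurry; fun_prop)
  have hint : ∀ {u : ℝ≥0∞ → ℝ≥0∞}, Measurable u → u ∞ = 0 →
      ∫⁻ z, (∫⁻ t in Set.Ici (0 : ℝ), u (ENNReal.ofReal t * (P.rnDeriv Q z)⁻¹)) ∂Q =
        ∫⁻ s in Set.Ici (0 : ℝ), u (ENNReal.ofReal s) := by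
    intro u hu hu_top
    rw [← lintegral_tsum_scaledTime_one hPQ hu hu_top]
    exact (lintegral_tsum_sourceLaw Q
      (φ := fun z t => u (ENNReal.ofReal t * (P.rnDeriv Q z)⁻¹))
      (by unfold Function.uncurry; fun_prop)).symm
  rw [hint hw hw_top, hint (u := fun s => w s ^ 2) (by fun_prop) (by simp [hw_top])] at h
  exact h

variable {Q P} in
theorem measure_exists_scaledTime_lt_le (hPQ : P.AbsolutelyContinuous Q) (τ : ℝ) :
    sourceLaw Q {ω | ∃ i, scaledTime Q P ω i < ENNReal.ofReal τ} ≤ ENNReal.ofReal τ := by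
  set w : ℝ≥0∞ → ℝ≥0∞ := (Set.Iio (ENNReal.ofReal τ)).indicator 1 with hwdef
  have hw : Measurable w := measurable_one.indicator measurableSet_Iio
  have hms : MeasurableSet {ω | ∃ i, scaledTime Q P ω i < ENNReal.ofReal τ} := by
    rw [Set.ofPred_exists]
    exact MeasurableSet.iUnion fun i =>
      measurableSet_lt (measurable_scaledTime Q P i) measurable_const
  calc sourceLaw Q {ω | ∃ i, scaledTime Q P ω i < ENNReal.ofReal τ}
      = ∫⁻ ω, {ω | ∃ i, scaledTime Q P ω i < ENNReal.ofReal τ}.indicator 1 ω ∂(sourceLaw Q) :=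
        (lintegral_indicator_one hms).symm
    _ ≤ ∫⁻ ω, ∑' i, w (scaledTime Q P ω i) ∂(sourceLaw Q) := by
        refine lintegral_mono fun ω => ?_
        by_cases hω : ∃ i, scaledTime Q P ω i < ENNReal.ofReal τ
        · rw [Set.indicator_of_mem (by exact hω)]
          obtain ⟨i, hi⟩ := hω
          refine le_trans ?_ (ENNReal.le_tsum i)
          simp [hwdef, hi]
        · rw [Set.indicator_of_notMem (by exact hω)]
          exact zero_le
    _ = ∫⁻ s in Set.Ici (0 : ℝ), w (ENNReal.ofReal s) :=
        lintegral_tsum_scaledTime_one hPQ hw (by simp [hwdef])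
    _ ≤ ∫⁻ s, (Set.Ico 0 τ).indicator 1 s := by
        rw [← lintegral_indicator measurableSet_Ici]
        refine lintegral_mono fun s => ?_
        by_cases hs : 0 ≤ s
        · simp [Set.indicator_apply, hwdef, hs, ENNReal.ofReal_lt_ofReal_iff_of_nonneg hs]
        · simp [hs]
    _ = ENNReal.ofReal τ := by
        rw [lintegral_indicator_one measurableSet_Ico, Real.volume_Ico, sub_zero]
end

/-! ### Chebyshev's inequality -/

/-- Chebyshev's inequality for an extended nonnegative random variable, from its first two
moments. -/
theorem meas_not_mem_Icc_le {Ω : Type*} [MeasurableSpace Ω] {μ : Measure Ω}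
    [IsProbabilityMeasure μ] {X : Ω → ℝ≥0∞} (hX : Measurable X) {m v c : ℝ} (hm : 0 ≤ m)
    (hc : 0 < c) (h1 : ∫⁻ ω, X ω ∂μ = ENNReal.ofReal m)
    (h2 : ∫⁻ ω, X ω ^ 2 ∂μ ≤ ENNReal.ofReal (m ^ 2 + v)) (hv : 0 ≤ v) :
    μ {ω | ¬ (ENNReal.ofReal (m - c) ≤ X ω ∧ X ω ≤ ENNReal.ofReal (m + c))} ≤
      ENNReal.ofReal (v / c ^ 2) := by
  have hfin : ∀ᵐ ω ∂μ, X ω < ∞ := ae_lt_top hX (by rw [h1]; exact ENNReal.ofReal_ne_top)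
  have hmean : ∫ ω, (X ω).toReal ∂μ = m := by
    rw [integral_toReal hX.aemeasurable hfin, h1, ENNReal.toReal_ofReal hm]
  have hfin2 : ∫⁻ ω, X ω ^ 2 ∂μ ≠ ∞ := ne_top_of_le_ne_top ENNReal.ofReal_ne_top h2
  have hint2 : Integrable (fun ω => (X ω).toReal ^ 2) μ := by
    simp_rw [← ENNReal.toReal_pow]
    exact integrable_toReal_of_lintegral_ne_top (hX.pow_const 2).aemeasurable hfin2
  have hLp : MemLp (fun ω => (X ω).toReal) 2 μ :=
    (memLp_two_iff_integrable_sq hX.ennreal_toReal.aestronglyMeasurable).mpr hint2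
  have hsecond : ∫ ω, (X ω).toReal ^ 2 ∂μ ≤ m ^ 2 + v := by
    simp_rw [← ENNReal.toReal_pow]
    rw [integral_toReal (hX.pow_const 2).aemeasurable
      (by filter_upwards [hfin] with ω h using ENNReal.pow_lt_top h)]
    exact ENNReal.toReal_le_of_le_ofReal (by positivity) h2
  have hvar : Var[fun ω => (X ω).toReal; μ] ≤ v := by
    rw [variance_eq_sub hLp, hmean]
    have : (μ[(fun ω => (X ω).toReal) ^ 2]) = ∫ ω, (X ω).toReal ^ 2 ∂μ := rfl
    linarith
  have hcheb := meas_ge_le_variance_div_sq hLp hc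
  rw [hmean] at hcheb
  refine le_trans (measure_mono_ae ?_) (hcheb.trans (ENNReal.ofReal_le_ofReal (by gcongr)))
  filter_upwards [hfin] with ω hω hbad
  change c ≤ |(X ω).toReal - m|
  by_contra hlt
  rw [not_le, abs_lt] at hlt
  refine hbad ⟨ENNReal.ofReal_le_of_le_toReal (by linarith), ?_⟩
  rw [← ENNReal.ofReal_toReal hω.ne]
  exact ENNReal.ofReal_le_ofReal (by linarith)

/-! ### Comparison of the densities of two neighbors -/

/-- Bernoulli's inequality `1 - α x ≤ (1 - x) ^ α` with `x = (a - b) / a`, in multiplicative form.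
The subtraction is truncated, so the last term vanishes when `a ≤ b`. -/
theorem rpow_le_rpow_add_sub_div_mul {α : ℝ} (hα : 1 ≤ α) {a b : ℝ≥0∞} (ha : a ≠ ∞) (hb : b ≠ ∞) :
    a ^ α ≤ b ^ α + ENNReal.ofReal α * ((a - b) / a) * a ^ α := by
  have hα0 : 0 < α := by linarith
  rcases le_or_gt a b with hab | hab
  · exact (ENNReal.rpow_le_rpow hab hα0.le).trans le_self_add
  · lift a to NNReal using ha
    lift b to NNReal using hb
    have hab' : (b : ℝ) < a := by exact_mod_cast hab
    have ha0 : (0 : ℝ) < a := b.coe_nonneg.trans_lt hab'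
    rw [← ENNReal.ofReal_coe_nnreal, ← ENNReal.ofReal_coe_nnreal,
      ← ENNReal.ofReal_sub _ b.coe_nonneg, ← ENNReal.ofReal_div_of_pos ha0,
      ENNReal.ofReal_rpow_of_nonneg a.coe_nonneg hα0.le,
      ENNReal.ofReal_rpow_of_nonneg b.coe_nonneg hα0.le,
      ← ENNReal.ofReal_mul hα0.le, ← ENNReal.ofReal_mul (by
        have := sub_nonneg.mpr hab'.le; positivity),
      ← ENNReal.ofReal_add (by positivity) (by
        have := sub_nonneg.mpr hab'.le; positivity)]
    refine ENNReal.ofReal_le_ofReal ?_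
    have hq : (b : ℝ) / a = 1 + -((a - b) / a) := by field_simp; ring
    have hB := one_add_mul_self_le_rpow_one_add (s := -(((a : ℝ) - b) / a))
      (by rw [neg_le_neg_iff, div_le_one ha0]; linarith [b.coe_nonneg]) hα
    rw [← hq, Real.div_rpow b.coe_nonneg a.coe_nonneg] at hB
    have hpos : 0 < (a : ℝ) ^ α := by positivity
    rw [le_div_iff₀ hpos] at hB
    linarith

theorem mul_inv_rpow_neg {α t : ℝ} (ht : 0 < t) {f : ℝ≥0∞} (hf : f ≠ ∞) :
    (ENNReal.ofReal t * f⁻¹) ^ (-α) = ENNReal.ofReal t ^ (-α) * f ^ α := by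
  rw [ENNReal.mul_rpow_of_ne_zero (by simpa using ht) (by simpa using hf), ENNReal.inv_rpow,
    ENNReal.rpow_neg f, inv_inv]

/-- The unnormalised selection weights of two distributions with density values `f`, `f'` at a mark
with arrival time `t`. -/
theorem mul_inv_rpow_neg_le {α t ε : ℝ} (hα : 1 ≤ α) (ht : 0 < t) {f f' : ℝ≥0∞} (hf : f ≠ ∞)
    (hf' : f' ≠ ∞) :
    (ENNReal.ofReal t * f⁻¹) ^ (-α) ≤
      ENNReal.ofReal (Real.exp (α * ε)) * (ENNReal.ofReal t * f'⁻¹) ^ (-α) +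
        ENNReal.ofReal α * ((f - ENNReal.ofReal (Real.exp ε) * f') / f) *
          (ENNReal.ofReal t * f⁻¹) ^ (-α) := by
  rw [mul_inv_rpow_neg ht hf, mul_inv_rpow_neg ht hf']
  have h := rpow_le_rpow_add_sub_div_mul hα hf
    (ENNReal.mul_ne_top (ENNReal.ofReal_ne_top (r := Real.exp ε)) hf')
  rw [ENNReal.mul_rpow_of_nonneg _ _ (by linarith),
    ENNReal.ofReal_rpow_of_pos (Real.exp_pos ε), ← Real.exp_mul, mul_comm ε α] at h
  calc _ ≤ ENNReal.ofReal t ^ (-α) * _ := mul_le_mul_right h _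
    _ = _ := by ring

section
variable {Z : Type*} [MeasurableSpace Z] {Q P P' : Measure Z} [IsProbabilityMeasure Q]
  [IsProbabilityMeasure P] [IsProbabilityMeasure P']

/-- An `(ε, δ)` guarantee bounds the mass of the positive part of `dP/dQ - e^ε dP'/dQ`. -/
theorem lintegral_rnDeriv_sub_le (hPQ : P.AbsolutelyContinuous Q) (hPQ' : P'.AbsolutelyContinuous Q)
    {ε δ : ℝ} (hP : ∀ S, MeasurableSet S →
      P S ≤ ENNReal.ofReal (Real.exp ε) * P' S + ENNReal.ofReal δ) :
    ∫⁻ z, P.rnDeriv Q z - ENNReal.ofReal (Real.exp ε) * P'.rnDeriv Q z ∂Q ≤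
      ENNReal.ofReal δ := by
  have hf := Measure.measurable_rnDeriv P Q
  have hf' := Measure.measurable_rnDeriv P' Q
  set g : Z → ℝ≥0∞ := fun z => ENNReal.ofReal (Real.exp ε) * P'.rnDeriv Q z
  have hg : Measurable g := by fun_prop
  set B := {z | g z < P.rnDeriv Q z}
  have hB : MeasurableSet B := measurableSet_lt hg hf
  have hgB : ∫⁻ z in B, g z ∂Q = ENNReal.ofReal (Real.exp ε) * P' B := by
    rw [lintegral_const_mul _ hf', Measure.setLIntegral_rnDeriv hPQ']
  calc ∫⁻ z, P.rnDeriv Q z - g z ∂Q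
      = ∫⁻ z in B, P.rnDeriv Q z - g z ∂Q := by
        rw [← lintegral_indicator hB]
        refine lintegral_congr fun z => ?_
        by_cases hz : z ∈ B
        · simp [hz]
        · simp only [hz, not_false_eq_true, Set.indicator_of_notMem]
          exact tsub_eq_zero_of_le (not_lt.mp hz)
    _ = P B - ENNReal.ofReal (Real.exp ε) * P' B := by
        rw [lintegral_sub hg, hgB, Measure.setLIntegral_rnDeriv hPQ]
        · rw [hgB]
          exact ENNReal.mul_ne_top ENNReal.ofReal_ne_top (measure_ne_top _ _)
        · filter_upwards [ae_restrict_mem hB] with z hz using le_of_lt hz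
    _ ≤ ENNReal.ofReal δ := tsub_le_iff_left.mpr (hP B hB)

end

/-! ### Inequalities between the parameters -/

/-- The only consequence of the condition on `α` that the argument uses. -/
theorem sub_one_le_of_le {α ε δ : ℝ} (hδ : 0 < δ ∧ δ ≤ 1 / 3)
    (h : α ≤ Real.exp (-4.2) * δ * ε ^ 2 / (-Real.log δ) + 1) :
    α - 1 ≤ δ * ε ^ 2 / 8 := by
  have hlog : 1 ≤ -Real.log δ := by
    have h3 : δ ≤ Real.exp (-1) := by
      rw [Real.exp_neg]
      refine hδ.2.trans ?_
      rw [one_div]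
      exact inv_anti₀ (Real.exp_pos 1) Real.exp_one_lt_three.le
    have := Real.log_le_log hδ.1 h3
    rw [Real.log_exp] at this
    linarith
  have hexp : Real.exp (-4.2) ≤ 1 / 8 := by
    have h1 : Real.exp (-4.2) ≤ Real.exp (-3) := Real.exp_le_exp.mpr (by norm_num)
    have h2 : Real.exp (-1) ≤ 1 / 2 := by
      rw [Real.exp_neg, one_div]
      exact inv_anti₀ (by norm_num) (by linarith [Real.exp_one_gt_d9])
    have h3 : Real.exp (-3) = Real.exp (-1) ^ 3 := by
      rw [← Real.exp_nat_mul]; norm_num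
    have h4 : Real.exp (-1) ^ 3 ≤ (1 / 2) ^ 3 := by gcongr
    norm_num at h4
    linarith
  have hδ0 := hδ.1
  calc α - 1 ≤ Real.exp (-4.2) * δ * ε ^ 2 / (-Real.log δ) := by linarith
    _ ≤ Real.exp (-4.2) * δ * ε ^ 2 := div_le_self (by positivity) hlog
    _ ≤ 1 / 8 * δ * ε ^ 2 := by gcongr
    _ = _ := by ring

/-- The bound of Chebyshev's inequality for the sum cut off at `τ = δ / 2`, which has mean
`τ ^ (1 - α) / (α - 1)`, at a deviation of `ε / 4` times the mean. -/
theorem variance_ratio_le {α ε δ : ℝ} (hα : 1 < α) (hε : 0 < ε ∧ ε ≤ 1) (hδ : 0 < δ)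
    (h : α - 1 ≤ δ * ε ^ 2 / 8) :
    (δ / 2) ^ (1 - 2 * α) / (2 * α - 1) / (ε / 4 * ((δ / 2) ^ (1 - α) / (α - 1))) ^ 2 ≤
      δ / 2 := by
  obtain ⟨hε0, hε1⟩ := hε
  have hτ : 0 < δ / 2 := by positivity
  have hp : (δ / 2) ^ (1 - 2 * α) = ((δ / 2) ^ (1 - α)) ^ 2 * (δ / 2)⁻¹ := by
    rw [← Real.rpow_natCast, ← Real.rpow_mul hτ.le, ← Real.rpow_neg_one, ← Real.rpow_add hτ]
    congr 1
    push_cast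
    ring
  have hm : 0 < (δ / 2) ^ (1 - α) := by positivity
  have ha : 0 < α - 1 := by linarith
  have ha2 : 1 ≤ 2 * α - 1 := by linarith
  rw [hp]
  calc _ = (32 * (α - 1) ^ 2 / (ε ^ 2 * δ)) / (2 * α - 1) := by field_simp; ring
    _ ≤ 32 * (α - 1) ^ 2 / (ε ^ 2 * δ) := div_le_self (by positivity) ha2
    _ ≤ 32 * (δ * ε ^ 2 / 8) ^ 2 / (ε ^ 2 * δ) := by gcongr
    _ = δ / 2 * ε ^ 2 := by field_simp; ring
    _ ≤ δ / 2 := mul_le_of_le_one_right hτ.le (pow_le_one₀ hε0.le hε1)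

/-! ### The privacy inequality -/

theorem condLaw_apply {Z : Type*} [MeasurableSpace Z] {Q P : Measure Z} (α : ℝ)
    (ω : (ℕ → Z) × (ℕ → ℝ)) {A : Set ((ℕ → Z) × ℕ)} (hA : MeasurableSet A) :
    condLaw α Q P ω A = ∑' k, selectProb α Q P ω k * A.indicator 1 (ω.1, k) := by
  simp only [condLaw, Measure.sum_apply _ hA, Measure.smul_apply, smul_eq_mul,
    Measure.dirac_apply' _ hA]

theorem law_apply {Z : Type*} [MeasurableSpace Z] {Q P : Measure Z} [IsProbabilityMeasure Q]
    (α : ℝ) {A : Set ((ℕ → Z) × ℕ)} (hA : MeasurableSet A) :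
    law α Q P A = ∫⁻ ω, condLaw α Q P ω A ∂(sourceLaw Q) :=
  Measure.bind_apply hA (measurable_condLaw α Q P).aemeasurable

theorem condLaw_le_one {Z : Type*} [MeasurableSpace Z] {Q P : Measure Z} (α : ℝ)
    (ω : (ℕ → Z) × (ℕ → ℝ)) {A : Set ((ℕ → Z) × ℕ)}
    (hA : MeasurableSet A) : condLaw α Q P ω A ≤ 1 := by
  rw [condLaw_apply α ω hA]
  calc ∑' k, selectProb α Q P ω k * A.indicator 1 (ω.1, k)
      ≤ ∑' k, selectProb α Q P ω k := by
        refine ENNReal.tsum_le_tsum fun k => mul_le_of_le_one_right' ?_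
        exact Set.indicator_le_self' (fun _ _ => zero_le) _
    _ ≤ 1 := by
        simp only [selectProb, div_eq_mul_inv]
        rw [ENNReal.tsum_mul_right, ← div_eq_mul_inv]
        exact ENNReal.div_self_le_one

/-- The sum `∑ T̃_i ^ (-α)` restricted to the rescaled points at level at least `τ`. -/
def truncSum {Z : Type*} [MeasurableSpace Z] (τ α : ℝ) (Q P : Measure Z)
    (ω : (ℕ → Z) × (ℕ → ℝ)) : ℝ≥0∞ :=
  ∑' i, truncPow τ α (scaledTime Q P ω i)

/-- The samples for which some rescaled point falls below `τ`, or the truncated sum deviates from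
its mean by more than the fraction `ε / 4`. -/
def badEvent {Z : Type*} [MeasurableSpace Z] (τ α ε : ℝ) (Q P : Measure Z) :
    Set ((ℕ → Z) × (ℕ → ℝ)) :=
  {ω | ∃ i, scaledTime Q P ω i < ENNReal.ofReal τ} ∪
    {ω | ¬ (ENNReal.ofReal (τ ^ (1 - α) / (α - 1) - ε / 4 * (τ ^ (1 - α) / (α - 1))) ≤
        truncSum τ α Q P ω ∧
      truncSum τ α Q P ω ≤
        ENNReal.ofReal (τ ^ (1 - α) / (α - 1) + ε / 4 * (τ ^ (1 - α) / (α - 1))))}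

/-- Outside the bad events of both distributions the two normalising sums are within a factor
`exp ε'` of each other, and the part of the selection weight of `P` that is not dominated by that
of `P'` is at most a Poisson sum over the points at level at least `τ`. -/
theorem condLaw_apply_le {Z : Type*} [MeasurableSpace Z] {Q P P' : Measure Z}
    {α ε ε' τ : ℝ} (hα : 1 < α) (hε' : 0 < ε' ∧ ε' ≤ 1) (hτ : 0 < τ)
    {A : Set ((ℕ → Z) × ℕ)} (hA : MeasurableSet A) {ω : (ℕ → Z) × (ℕ → ℝ)}
    (hpos : ∀ i, 0 < arrival ω.2 i) (hf : ∀ i, P.rnDeriv Q (ω.1 i) ≠ ∞)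
    (hf' : ∀ i, P'.rnDeriv Q (ω.1 i) ≠ ∞) (hω : ω ∉ badEvent τ α ε' Q P)
    (hω' : ω ∉ badEvent τ α ε' Q P') :
    condLaw α Q P ω A ≤ ENNReal.ofReal (Real.exp (α * ε + ε')) * condLaw α Q P' ω A +
      ENNReal.ofReal (4 / 3 / (τ ^ (1 - α) / (α - 1))) *
        ∑' k, ENNReal.ofReal α * ((P.rnDeriv Q (ω.1 k) -
          ENNReal.ofReal (Real.exp ε) * P'.rnDeriv Q (ω.1 k)) / P.rnDeriv Q (ω.1 k)) *
          truncPow τ α (scaledTime Q P ω k) := by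
  obtain ⟨hε0, hε1⟩ := hε'
  set m := τ ^ (1 - α) / (α - 1) with hm
  have hm0 : 0 < m := div_pos (Real.rpow_pos_of_pos hτ _) (by linarith)
  simp only [badEvent, Set.mem_union, Set.mem_ofPred_eq, not_or, not_exists, not_not] at hω hω'
  obtain ⟨hge, hlow, -⟩ := hω
  obtain ⟨hge', -, hup⟩ := hω'
  set S := ∑' i, scaledTime Q P ω i ^ (-α) with hS
  set S' := ∑' i, scaledTime Q P' ω i ^ (-α) with hS'
  have hlowS : ENNReal.ofReal (3 / 4 * m) ≤ S := by
    refine le_trans (ENNReal.ofReal_le_ofReal ?_)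
      (hlow.trans (ENNReal.tsum_le_tsum fun i => truncPow_le _ _ _))
    nlinarith
  have hratio : S' ≤ ENNReal.ofReal (Real.exp ε') * S := by
    calc S' = truncSum τ α Q P' ω :=
          tsum_congr fun i => (truncPow_of_not_lt α (hge' i)).symm
      _ ≤ ENNReal.ofReal (m + ε' / 4 * m) := hup
      _ ≤ ENNReal.ofReal (Real.exp ε') * ENNReal.ofReal (m - ε' / 4 * m) := by
          rw [← ENNReal.ofReal_mul (Real.exp_pos _).le]
          refine ENNReal.ofReal_le_ofReal ?_
          -- `(1 + x) / (1 - x) ≤ 1 + 4 x` for `x = ε' / 4 ≤ 1 / 4`.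
          have h1 : 1 + ε' / 4 ≤ Real.exp ε' * (1 - ε' / 4) := by
            have := Real.add_one_le_exp ε'
            have h2 : 0 ≤ 1 - ε' / 4 := by linarith
            nlinarith
          calc m + ε' / 4 * m = (1 + ε' / 4) * m := by ring
            _ ≤ (Real.exp ε' * (1 - ε' / 4)) * m := by gcongr
            _ = _ := by ring
      _ ≤ ENNReal.ofReal (Real.exp ε') * S := by
          gcongr
          exact hlow.trans (ENNReal.tsum_le_tsum fun i => truncPow_le _ _ _)
  have hE0 : ENNReal.ofReal (Real.exp ε') ≠ 0 := by simp [Real.exp_pos]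
  have hinv : S⁻¹ ≤ ENNReal.ofReal (Real.exp ε') * S'⁻¹ := by
    have h1 := ENNReal.inv_le_inv.mpr hratio
    rw [ENNReal.mul_inv (Or.inl hE0) (Or.inl ENNReal.ofReal_ne_top)] at h1
    calc S⁻¹ = ENNReal.ofReal (Real.exp ε') * ((ENNReal.ofReal (Real.exp ε'))⁻¹ * S⁻¹) := by
          rw [← mul_assoc, ENNReal.mul_inv_cancel hE0 ENNReal.ofReal_ne_top, one_mul]
      _ ≤ _ := by gcongr
  have hinv2 : S⁻¹ ≤ ENNReal.ofReal (4 / 3 / m) := by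
    refine (ENNReal.inv_le_inv.mpr hlowS).trans_eq ?_
    rw [← ENNReal.ofReal_inv_of_pos (by positivity)]
    congr 1
    field_simp
  rw [condLaw_apply α ω hA, condLaw_apply α ω hA, ← ENNReal.tsum_mul_left,
    ← ENNReal.tsum_mul_left, ← ENNReal.tsum_add]
  refine ENNReal.tsum_le_tsum fun k => ?_
  set ψ := ENNReal.ofReal α * ((P.rnDeriv Q (ω.1 k) -
    ENNReal.ofReal (Real.exp ε) * P'.rnDeriv Q (ω.1 k)) / P.rnDeriv Q (ω.1 k))
  set χ : ℝ≥0∞ := A.indicator 1 (ω.1, k)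
  have hχ : χ ≤ 1 := Set.indicator_le_self' (fun _ _ => zero_le) _
  have hpt : scaledTime Q P ω k ^ (-α) ≤ ENNReal.ofReal (Real.exp (α * ε)) *
      scaledTime Q P' ω k ^ (-α) + ψ * scaledTime Q P ω k ^ (-α) :=
    mul_inv_rpow_neg_le hα.le (hpos k) (hf k) (hf' k)
  rw [truncPow_of_not_lt α (hge k)]
  simp only [selectProb, ← hS, ← hS', div_eq_mul_inv]
  set R := scaledTime Q P ω k ^ (-α)
  set R' := scaledTime Q P' ω k ^ (-α)
  calc R * S⁻¹ * χ
      ≤ (ENNReal.ofReal (Real.exp (α * ε)) * R' + ψ * R) * S⁻¹ * χ := by gcongr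
    _ = ENNReal.ofReal (Real.exp (α * ε)) * R' * S⁻¹ * χ + ψ * R * S⁻¹ * χ := by ring
    _ ≤ ENNReal.ofReal (Real.exp (α * ε)) * R' * (ENNReal.ofReal (Real.exp ε') * S'⁻¹) * χ +
          ψ * R * ENNReal.ofReal (4 / 3 / m) * 1 := by gcongr
    _ = _ := by
        rw [Real.exp_add, ENNReal.ofReal_mul (Real.exp_pos _).le]
        simp only [div_eq_mul_inv]
        ring

section
variable {Z : Type*} [MeasurableSpace Z] {Q P P' : Measure Z} [IsProbabilityMeasure Q]
  [IsProbabilityMeasure P] [IsProbabilityMeasure P']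

theorem measure_badEvent_le (hPQ : P.AbsolutelyContinuous Q) {α ε δ : ℝ} (hα : 1 < α)
    (hε : 0 < ε ∧ ε ≤ 1) (hδ : 0 < δ) (h : α - 1 ≤ δ * ε ^ 2 / 8) :
    sourceLaw Q (badEvent (δ / 2) α ε Q P) ≤ ENNReal.ofReal δ := by
  have hτ : 0 < δ / 2 := by positivity
  have hα1 : 0 < α - 1 := by linarith
  have hα2 : 0 < 2 * α - 1 := by linarith
  have hε0 := hε.1
  have hcheb := meas_not_mem_Icc_le (μ := sourceLaw Q) (X := truncSum (δ / 2) α Q P)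
    (m := (δ / 2) ^ (1 - α) / (α - 1)) (v := (δ / 2) ^ (1 - 2 * α) / (2 * α - 1))
    (c := ε / 4 * ((δ / 2) ^ (1 - α) / (α - 1)))
    (Measurable.tsum fun i => (measurable_truncPow _ _).comp (measurable_scaledTime Q P i))
    (by positivity) (by positivity)
    ((lintegral_tsum_scaledTime_one hPQ (measurable_truncPow _ _)
      (truncPow_top (by linarith))).trans (lintegral_truncPow hτ hα))
    (by
      refine (lintegral_sq_tsum_scaledTime_le hPQ (measurable_truncPow _ _)
        (truncPow_top (by linarith))).trans ?_
      simp_rw [truncPow_sq]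
      rw [lintegral_truncPow hτ hα, lintegral_truncPow hτ (by linarith),
        ← ENNReal.ofReal_pow (by positivity), ← ENNReal.ofReal_add (by positivity)
          (by positivity)])
    (by positivity)
  calc sourceLaw Q (badEvent (δ / 2) α ε Q P)
      ≤ ENNReal.ofReal (δ / 2) + ENNReal.ofReal (δ / 2) := by
        refine (measure_union_le _ _).trans (add_le_add ?_ ?_)
        · exact measure_exists_scaledTime_lt_le hPQ _
        · exact hcheb.trans (ENNReal.ofReal_le_ofReal (variance_ratio_le hα hε hδ h))
    _ = ENNReal.ofReal δ := by
        rw [← ENNReal.ofReal_add hτ.le hτ.le, add_halves]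

/-- The mean of the excess weight. The factor `4 / 3` comes from the lower bound `3 / 4` of the
normalising sum relative to its mean, and `4 α / 3 ≤ 2`. -/
theorem lintegral_excess_le (hPQ : P.AbsolutelyContinuous Q) (hPQ' : P'.AbsolutelyContinuous Q)
    {α ε δ τ : ℝ} (hα : 1 < α) (hα2 : α ≤ 3 / 2) (hτ : 0 < τ) (hδ : 0 ≤ δ)
    (hP : ∀ S, MeasurableSet S →
      P S ≤ ENNReal.ofReal (Real.exp ε) * P' S + ENNReal.ofReal δ) :
    ENNReal.ofReal (4 / 3 / (τ ^ (1 - α) / (α - 1))) *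
      ∫⁻ ω, ∑' k, ENNReal.ofReal α * ((P.rnDeriv Q (ω.1 k) -
          ENNReal.ofReal (Real.exp ε) * P'.rnDeriv Q (ω.1 k)) / P.rnDeriv Q (ω.1 k)) *
          truncPow τ α (scaledTime Q P ω k) ∂(sourceLaw Q) ≤ ENNReal.ofReal (2 * δ) := by
  have hf := Measure.measurable_rnDeriv P Q
  have hf' := Measure.measurable_rnDeriv P' Q
  have hm0 : 0 < τ ^ (1 - α) / (α - 1) := div_pos (Real.rpow_pos_of_pos hτ _) (by linarith)
  have hα0 : 0 < α := by linarith
  rw [lintegral_tsum_scaledTime Q P (ψ := fun z => ENNReal.ofReal α * ((P.rnDeriv Q z -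
    ENNReal.ofReal (Real.exp ε) * P'.rnDeriv Q z) / P.rnDeriv Q z)) (by fun_prop)
    (measurable_truncPow τ α) (truncPow_top hα0), lintegral_truncPow hτ hα]
  have hψ : ∫⁻ z, ENNReal.ofReal α * ((P.rnDeriv Q z -
      ENNReal.ofReal (Real.exp ε) * P'.rnDeriv Q z) / P.rnDeriv Q z) * P.rnDeriv Q z ∂Q ≤
      ENNReal.ofReal α * ENNReal.ofReal δ := by
    refine le_trans ?_ (mul_le_mul_right (lintegral_rnDeriv_sub_le hPQ hPQ' hP) _)
    rw [← lintegral_const_mul _ (by fun_prop)]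
    refine lintegral_mono fun z => ?_
    rw [mul_assoc]
    gcongr
    exact ENNReal.mul_le_of_le_div le_rfl
  calc _ ≤ ENNReal.ofReal (4 / 3 / (τ ^ (1 - α) / (α - 1))) *
        (ENNReal.ofReal α * ENNReal.ofReal δ * ENNReal.ofReal (τ ^ (1 - α) / (α - 1))) := by
        gcongr
    _ = ENNReal.ofReal (4 / 3 * α * δ) := by
        rw [← ENNReal.ofReal_mul hα0.le, ← ENNReal.ofReal_mul (by positivity),
          ← ENNReal.ofReal_mul (by positivity)]
        congr 1
        rw [← mul_assoc, mul_comm, ← mul_assoc, mul_div_cancel₀ _ hm0.ne']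
        ring
    _ ≤ ENNReal.ofReal (2 * δ) := ENNReal.ofReal_le_ofReal (by nlinarith)

/-- The privacy inequality for a single ordered pair of target distributions. -/
theorem law_apply_le (hPQ : P.AbsolutelyContinuous Q) (hPQ' : P'.AbsolutelyContinuous Q)
    {α ε δ ε' δ' : ℝ} (hα : 1 < α) (hδ : 0 ≤ δ) (hε' : 0 < ε' ∧ ε' ≤ 1)
    (hδ' : 0 < δ' ∧ δ' ≤ 1 / 3) (h : α - 1 ≤ δ' * ε' ^ 2 / 8)
    (hP : ∀ S, MeasurableSet S →
      P S ≤ ENNReal.ofReal (Real.exp ε) * P' S + ENNReal.ofReal δ)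
    {A : Set ((ℕ → Z) × ℕ)} (hA : MeasurableSet A) :
    law α Q P A ≤ ENNReal.ofReal (Real.exp (α * ε + ε')) * law α Q P' A +
      ENNReal.ofReal (2 * (δ + δ')) := by
  have hf := Measure.measurable_rnDeriv P Q
  have hf' := Measure.measurable_rnDeriv P' Q
  have hα2 : α ≤ 3 / 2 := by
    have h1 : ε' ^ 2 ≤ 1 := pow_le_one₀ hε'.1.le hε'.2
    nlinarith [hδ'.1, hδ'.2, sq_nonneg ε']
  have hτ : 0 < δ' / 2 := by linarith [hδ'.1]
  set B := badEvent (δ' / 2) α ε' Q P ∪ badEvent (δ' / 2) α ε' Q P'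
  have hB : sourceLaw Q B ≤ ENNReal.ofReal (2 * δ') := by
    rw [two_mul, ENNReal.ofReal_add hδ'.1.le hδ'.1.le]
    exact (measure_union_le _ _).trans (add_le_add
      (measure_badEvent_le hPQ hα hε' hδ'.1 h) (measure_badEvent_le hPQ' hα hε' hδ'.1 h))
  set C := ENNReal.ofReal (4 / 3 / ((δ' / 2) ^ (1 - α) / (α - 1)))
  set D : (ℕ → Z) × (ℕ → ℝ) → ℝ≥0∞ := fun ω => ∑' k, ENNReal.ofReal α *
    ((P.rnDeriv Q (ω.1 k) - ENNReal.ofReal (Real.exp ε) * P'.rnDeriv Q (ω.1 k)) /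
      P.rnDeriv Q (ω.1 k)) * truncPow (δ' / 2) α (scaledTime Q P ω k)
  have hD : Measurable D := by
    refine Measurable.tsum fun k => ?_
    have := measurable_scaledTime Q P k
    fun_prop
  have hcond : Measurable fun ω => condLaw α Q P' ω A :=
    (Measure.measurable_coe hA).comp (measurable_condLaw α Q P')
  calc law α Q P A = ∫⁻ ω, condLaw α Q P ω A ∂(sourceLaw Q) := law_apply α hA
    _ ≤ ∫⁻ ω, (B.indicator 1 ω +
          (ENNReal.ofReal (Real.exp (α * ε + ε')) * condLaw α Q P' ω A + C * D ω))
          ∂(sourceLaw Q) := by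
        refine lintegral_mono_ae ?_
        filter_upwards [ae_sourceLaw_arrival_pos Q,
          ae_sourceLaw_sample Q (Measure.rnDeriv_ne_top P Q),
          ae_sourceLaw_sample Q (Measure.rnDeriv_ne_top P' Q)] with ω hpos hfin hfin'
        by_cases hω : ω ∈ B
        · rw [Set.indicator_of_mem hω]
          exact (condLaw_le_one α ω hA).trans le_self_add
        · rw [Set.indicator_of_notMem hω, zero_add]
          exact condLaw_apply_le hα hε' hτ hA hpos hfin hfin' (fun h => hω (Or.inl h))
            (fun h => hω (Or.inr h))
    _ = ∫⁻ ω, B.indicator 1 ω ∂(sourceLaw Q) +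
          (ENNReal.ofReal (Real.exp (α * ε + ε')) * law α Q P' A +
            C * ∫⁻ ω, D ω ∂(sourceLaw Q)) := by
        rw [lintegral_add_right _ (by fun_prop), lintegral_add_left (by fun_prop),
          lintegral_const_mul _ hcond, lintegral_const_mul _ hD, law_apply α hA]
    _ ≤ ENNReal.ofReal (2 * δ') + (ENNReal.ofReal (Real.exp (α * ε + ε')) * law α Q P' A +
          ENNReal.ofReal (2 * δ)) := by
        gcongr
        · exact (lintegral_indicator_one_le B).trans hB
        · exact lintegral_excess_le hPQ hPQ' hα hα2 hτ hδ hP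
    _ = _ := by
        rw [mul_add, add_comm (2 * δ), ENNReal.ofReal_add (by linarith [hδ'.1]) (by linarith)]
        ring

end

end PPR

end

theorem mainTheorem4 {X Z : Type*} [MeasurableSpace Z]
    (N : X → X → Prop) (hN : ∀ x x' : X, N x x' → N x' x)
    (P : X → Measure Z) [∀ x, IsProbabilityMeasure (P x)]
    (Q : Measure Z) [IsProbabilityMeasure Q] (hPQ : ∀ x, (P x).AbsolutelyContinuous Q)
    (ε δ : ℝ) (hε : 0 ≤ ε) (hδ : 0 ≤ δ)
    (hP : IsDifferentiallyPrivate N P ε δ)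
    (α : ℝ) (hα : 1 < α)
    (ε' δ' : ℝ) (hε' : 0 < ε' ∧ ε' ≤ 1) (hδ' : 0 < δ' ∧ δ' ≤ 1 / 3)
    (hαle : α ≤ Real.exp (-4.2) * δ' * ε' ^ 2 / (-Real.log δ') + 1) :
    IsDifferentiallyPrivate N (fun x => PPR.law α Q (P x))
      (α * ε + ε') (2 * (δ + δ')) :=
  fun x x' hx _ hA => PPR.law_apply_le (hPQ x) (hPQ x') hα hδ hε' hδ'
    (PPR.sub_one_le_of_le hδ' hαle) (hP x x' hx) hA
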